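/- Let $G$ be a group. For $g\in G$ let $t(g)$ be the set of all positive integers $n$ for which there are $x_1,\dots,x_n\in G$ with $(x_1gx_1^{-1})(x_2gx_2^{-1})\cdots(x_ngx_n^{-1})=1$. A non-trivial element $g\in G$ is called a generalized torsion element if $t(g)\neq\emptyset$, and its generalized torsion order is $gord(g)=\min t(g)$ (with $gord(g)=\infty$ if $t(g)=\emptyset$). Put \[ gord(G)=\{gord(g) \mid g \text{ is a generalized torsion element of } G\}, \] \[ gord^{*}(G)=\{gord(g) \mid g \text{ is a generalized torsion element of } G \text{ of infinite order}\}. \] A group is torsion-free if its only element of finite order is the identity. **Corollary.** For every subset $A\subset\mathbb{N}_{\geq 2}$ there exists a countable, torsion-free group $G$ such that \[ gord^{*}(G)=gord(G)=A. \] Moreover, $G$ can be taken to be a free product of a family $(G_n)_{n\in A}$ of countable, torsion-free groups with $gord^{*}(G_n)=gord(G_n)=\{n\}$ for every $n\in A$ (the trivial group if $A=\emptyset$). -/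

import Mathlib

namespace GenTorsion

/-- The generalized torsion equation spectrum `t(g)`: the positive integers `n` such that
`(x₁ g x₁⁻¹) ⋯ (xₙ g xₙ⁻¹) = 1` for some `x₁, …, xₙ` in `G`. -/
def eqnSpectrum {G : Type*} [Group G] (g : G) : Set ℕ :=
  {n | 0 < n ∧ ∃ x : Fin n → G, (List.ofFn fun i => x i * g * (x i)⁻¹).prod = 1}

/-- A generalized torsion element: a non-trivial element some non-empty finite product of
conjugates of which is the identity. -/
def IsGenTorsion {G : Type*} [Group G] (g : G) : Prop :=
  g ≠ 1 ∧ (eqnSpectrum g).Nonempty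

/-- The generalized torsion order, the minimum of `t(g)`; it is `⊤` when `t(g)` is empty. -/
noncomputable def gord {G : Type*} [Group G] (g : G) : ℕ∞ :=
  sInf ((fun n : ℕ => (n : ℕ∞)) '' eqnSpectrum g)

/-- The generalized torsion order spectrum: the orders of all generalized torsion elements. -/
def gordSpectrum (G : Type*) [Group G] : Set ℕ :=
  {n | ∃ g : G, IsGenTorsion g ∧ gord g = (n : ℕ∞)}

/-- The strict generalized torsion order spectrum: the orders of all generalized torsion
elements that are not torsion elements. -/
def strictGordSpectrum (G : Type*) [Group G] : Set ℕ :=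
  {n | ∃ g : G, IsGenTorsion g ∧ ¬ IsOfFinOrder g ∧ gord g = (n : ℕ∞)}

/-- A torsion-free group: only the identity has finite order. (Mathlib's `IsMulTorsionFree`
asks for injective power maps, which is stronger for non-commutative groups.) -/
def TorsionFree (G : Type*) [Group G] : Prop :=
  ∀ g : G, IsOfFinOrder g → g = 1

end GenTorsion

/-! For `n ≥ 2` let ℤ act on ℚ through multiplication by `1 - n`. A generalized torsion element of ℚ
⋊ ℤ lies in ℚ, and the conjugates of `a` in ℚ are the numbers `(1 - n) ^ e * a`. If `k` such powers
sum to zero then `n ∣ k`, because `1 - n` is 1 modulo `n`; and `(1 - n) + (n - 1) * 1 = 0` attains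
`n`. So this group has spectrum `{n}`, and it remains to see that free products of torsion-free
groups have no new orders (`gordSpectrum_coprodI`).

The point is that generalized torsion elements of such a product are conjugate into a factor
(`exists_conj_of_nonempty_eqnSpectrum`). Otherwise some cyclically reduced word `W` of length `L ≥
2` has `k` conjugates with product 1. The word of this product bounds a disc
(`circleFilling_of_prod_eq_one`), and cutting off the conjugators (`CircleFilling.cut_conj`) leaves
a planar surface with `k` boundary circles, each spelling `W`. The surface is encoded by
permutations `α` and `σ * α⁻¹` of the `k * L` letters. As for a sphere of Euler characteristic 2,
they have together at least `k * L + 2 - k` labelled cycles. Measure each step of a cycle by the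
drop in position modulo `L`. The labels cost at least `L` each, since the letters of `W` have
infinite order and neighbours lie in different factors. The total cost is `k * L * (L - 1)`, so
there are at most `k * (L - 1)` labels, a contradiction (`Filling.false_of_card_eq`). -/

open Equiv Monoid

/-! ### Planar surfaces as permutations, and surgery on them -/

section Fillings

variable {Z I G : Type*} [DecidableEq Z] [Group G]

/-- `p` is a partial labelling of the points that is constant on the cycles of `γ` and takes every
value in `S`; hence `γ` has at least `S.card` labelled cycles. -/
def IsLabelling (γ : Perm Z) (p : Z → Option ℕ) (S : Finset ℕ) : Prop :=
  (∀ z, p (γ z) = p z) ∧ ∀ m ∈ S, ∃ z, p z = some m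

/-- `f` is a potential for the letters `v` along the labelled cycles of `α`: the product of the
letters along such a cycle is trivial. -/
def IsPotential (α : Perm Z) (p : Z → Option ℕ) (v f : Z → G) : Prop :=
  ∀ z, p z ≠ none → f (α z) = f z * v z

/-- A combinatorial planar surface whose boundary circles are the `k` cycles of `σ` on `live`, with
letters `v` coloured by `c`: the cycles of `α` bound pieces mapped to a factor, and the
cycles of `σ * α⁻¹` bound the remaining pieces. -/
def Filling (c : Z → I) (v : Z → G) (σ : Perm Z) (live : Finset Z) (k : ℕ) : Prop :=
  ∃ (α : Perm Z) (p q : Z → Option ℕ) (f : Z → G) (S T : Finset ℕ),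
    (∀ z, c (α z) = c z) ∧ (∀ z, z ∉ live → α z = z ∧ p z = none ∧ q z = none) ∧
    IsLabelling α p S ∧ IsLabelling (σ * α⁻¹) q T ∧ IsPotential α p v f ∧
    live.card + 2 ≤ S.card + T.card + k

theorem IsLabelling.erase_of_fixed {γ : Perm Z} {q : Z → Option ℕ} {T : Finset ℕ}
    (h : IsLabelling γ q T) {y : Z} (hy : γ y = y) :
    ∃ T', IsLabelling γ (Function.update q y none) T' ∧ T.card ≤ T'.card + 1 := by
  refine ⟨T.filter (fun m => q y ≠ some m), ⟨fun z => ?_, fun m hm => ?_⟩, ?_⟩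
  · by_cases hz : z = y
    · subst hz; rw [hy]
    · have : γ z ≠ y := fun e => hz (γ.injective (e.trans hy.symm))
      simp [Function.update_of_ne hz, Function.update_of_ne this, h.1]
  · rw [Finset.mem_filter] at hm
    obtain ⟨z, hz⟩ := h.2 m hm.1
    refine ⟨z, ?_⟩
    rw [Function.update_of_ne, hz]
    rintro rfl
    exact hm.2 hz
  · cases e : q y with
    | none => simp
    | some m =>
      have : T.erase m ⊆ T.filter (fun m' => some m ≠ some m') := by
        intro a ha
        rw [Finset.mem_erase] at ha
        simp [ha.2, Ne.symm ha.1]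
      have h1 := Finset.card_le_card this
      have h2 := Finset.pred_card_le_card_erase (s := T) (a := m)
      omega

/-- The cycle of `y` loses only `y` and, as `y` is not fixed, keeps another point, so every label
survives. -/
theorem IsLabelling.detach {γ : Perm Z} {q : Z → Option ℕ} {T : Finset ℕ}
    (h : IsLabelling γ q T) {y : Z} (hy : γ y ≠ y) :
    IsLabelling (swap y (γ y) * γ) (Function.update q y none) T := by
  refine ⟨fun z => ?_, fun m hm => ?_⟩
  · by_cases hz : z = y
    · subst hz; simp
    · have h1 : γ z ≠ γ y := fun e => hz (γ.injective e)
      by_cases h2 : γ z = y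
      · have h3 : q y = q z := by rw [← h.1 z, h2]
        simp [h2, Function.update_of_ne hz, Function.update_of_ne hy, h.1, h3]
      · simp [swap_apply_of_ne_of_ne h2 h1, Function.update_of_ne hz, Function.update_of_ne h2, h.1]
  · obtain ⟨z, hz⟩ := h.2 m hm
    by_cases hzy : z = y
    · exact ⟨γ y, by rw [Function.update_of_ne hy, h.1, ← hzy, hz]⟩
    · exact ⟨z, by rw [Function.update_of_ne hzy, hz]⟩

/-- A transposition joins two cycles or splits one. Giving the whole class of `y` the label of `x`
keeps the labelling invariant and loses at most one label. -/
theorem IsLabelling.mul_swap {γ : Perm Z} {q : Z → Option ℕ} {T : Finset ℕ}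
    (h : IsLabelling γ q T) (x y : Z) :
    ∃ q' T', IsLabelling (γ * swap x y) q' T' ∧ T.card ≤ T'.card + 1 ∧
      ∀ z, q z = none → q' z = none := by
  have key : ∀ x y : Z, ∀ m, q y = some m →
    ∃ q' T', IsLabelling (γ * swap x y) q' T' ∧ T.card ≤ T'.card + 1 ∧
      ∀ z, q z = none → q' z = none := by
    intro x y m hm
    refine ⟨fun z => if q z = some m then q x else q z, T.erase m, ⟨fun z => ?_, ?_⟩, ?_, ?_⟩
    · by_cases hx : z = x
      · subst hx; simp [h.1, hm]
      · by_cases hy : z = y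
        · subst hy; simp [h.1, hm]
        · simp [swap_apply_of_ne_of_ne hx hy, h.1]
    · intro m' hm'
      rw [Finset.mem_erase] at hm'
      obtain ⟨z, hz⟩ := h.2 m' hm'.2
      exact ⟨z, by simp [hz, hm'.1]⟩
    · have h2 := Finset.pred_card_le_card_erase (s := T) (a := m)
      omega
    · intro z hz
      simp [hz]
  cases hy : q y with
  | some m => exact key x y m hy
  | none =>
    cases hx : q x with
    | some m => rw [swap_comm]; exact key y x m hx
    | none =>
      refine ⟨q, T, ⟨fun z => ?_, h.2⟩, by omega, fun _ => id⟩
      rw [Perm.mul_apply, h.1]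
      by_cases h1 : z = x
      · subst h1; simp [hx, hy]
      · by_cases h2 : z = y
        · subst h2; simp [hx, hy]
        · rw [swap_apply_of_ne_of_ne h1 h2]

theorem IsPotential.mul_swap {α : Perm Z} {p : Z → Option ℕ} {S : Finset ℕ} {v f : Z → G}
    (h : IsLabelling α p S) (hf : IsPotential α p v f) (x y : Z) :
    ∃ p' S' f', IsLabelling (α * swap x y) p' S' ∧ IsPotential (α * swap x y) p' v f' ∧
      S.card ≤ S'.card + 1 ∧ ∀ z, p z = none → p' z = none := by
  by_cases hc : p x ≠ none ∧ p y ≠ none ∧ p x ≠ p y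
  · obtain ⟨hx, hy, hxy⟩ := hc
    obtain ⟨m, hm⟩ := Option.ne_none_iff_exists'.1 hy
    refine ⟨fun z => if p z = some m then p x else p z, S.erase m,
      -- Left translation preserves potentials on a class; this translate takes the value `f x * v
      -- x` at `α y`, as the joined cycle requires.
      fun z => if p z = some m then (f x * v x * (f y * v y)⁻¹) * f z else f z,
      ⟨fun z => ?_, ?_⟩, fun z hz => ?_, ?_, ?_⟩
    · by_cases hzx : z = x
      · subst hzx; simp [h.1, hm]
      · by_cases hzy : z = y
        · subst hzy; simp [h.1, hm]
        · simp [swap_apply_of_ne_of_ne hzx hzy, h.1]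
    · intro m' hm'
      rw [Finset.mem_erase] at hm'
      obtain ⟨z, hz⟩ := h.2 m' hm'.2
      exact ⟨z, by simp [hz, hm'.1]⟩
    · rw [hm] at hxy
      by_cases hzx : z = x
      · subst hzx; simp [h.1, hm, hxy, hf y hy]; group
      · by_cases hzy : z = y
        · subst hzy; simp [h.1, hm, hxy, hf x hx, mul_assoc]
        · have hz' : p z ≠ none := by
            intro e; simp [e] at hz
          simp only [Perm.mul_apply, swap_apply_of_ne_of_ne hzx hzy, h.1, hf z hz']
          split_ifs <;> simp [mul_assoc]
    · have h2 := Finset.pred_card_le_card_erase (s := S) (a := m)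
      omega
    · intro z hz
      simp [hz]
  -- Here the labels of `x` and `y` agree or one is already `none`, so erasing both classes costs at
  -- most one label.
  · refine ⟨fun z => if p z = p x ∨ p z = p y then none else p z,
      S.filter (fun m => some m ≠ p x ∧ some m ≠ p y), f, ⟨fun z => ?_, ?_⟩, fun z hz => ?_, ?_, ?_⟩
    · by_cases hzx : z = x
      · subst hzx; simp [h.1]
      · by_cases hzy : z = y
        · subst hzy; simp [h.1]
        · simp [swap_apply_of_ne_of_ne hzx hzy, h.1]
    · intro m hm
      rw [Finset.mem_filter] at hm
      obtain ⟨z, hz⟩ := h.2 m hm.1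
      exact ⟨z, by simp [hz, hm.2]⟩
    · have hzx : z ≠ x := by rintro rfl; simp at hz
      have hzy : z ≠ y := by rintro rfl; simp at hz
      have hz' : p z ≠ none := by
        intro e; simp [e] at hz
      simp [swap_apply_of_ne_of_ne hzx hzy, hf z hz']
    · have : ∃ m, S.erase m ⊆ S.filter (fun m => some m ≠ p x ∧ some m ≠ p y) := by
        cases hx : p x with
        | none =>
          cases hy : p y with
          | none => exact ⟨0, fun a ha => by simp_all⟩
          | some m => exact ⟨m, fun a ha => by simp_all⟩
        | some m =>
          refine ⟨m, fun a ha => ?_⟩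
          cases hy : p y with
          | none => simp_all
          | some m' => simp_all
      obtain ⟨m, hm⟩ := this
      have h1 := Finset.card_le_card hm
      have h2 := Finset.pred_card_le_card_erase (s := S) (a := m)
      omega
    · intro z hz
      simp [hz]

variable {c : Z → I} {v : Z → G} {σ : Perm Z} {live : Finset Z} {k : ℕ}

theorem Filling.congr {v' : Z → G} (h : Filling c v σ live k) (hv : ∀ z ∈ live, v z = v' z) :
    Filling c v' σ live k := by
  obtain ⟨α, p, q, f, S, T, hc, hd, hp, hq, hf, hn⟩ := h
  refine ⟨α, p, q, f, S, T, hc, hd, hp, hq, fun z hz => ?_, hn⟩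
  rw [hf z hz, hv]
  by_contra hz'
  exact hz (hd z hz').2.1

/-- `α` is untouched, while `σ * α⁻¹` is multiplied by a transposition; the label it may lose is
paid for by the extra circle. -/
theorem Filling.cut (h : Filling c v σ live k) (a b : Z) :
    Filling c v (σ * swap a b) live (k + 1) := by
  obtain ⟨α, p, q, f, S, T, hc, hd, hp, hq, hf, hn⟩ := h
  obtain ⟨q', T', h1, h2, h3⟩ := hq.mul_swap (α a) (α b)
  refine ⟨α, p, q', f, S, T', hc, fun z hz => ⟨(hd z hz).1, (hd z hz).2.1, h3 z (hd z hz).2.2⟩,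
    hp, ?_, hf, by omega⟩
  convert h1 using 1
  rw [Equiv.swap_apply_apply]
  group

/-- The lost point pays for one label. If `α` fixes `y`, that is the label of `y` in `p`; otherwise
`y` leaves its `α`-cycle for free, its letter being trivial, and only `σ * α⁻¹` may lose a label. -/
theorem Filling.kill (h : Filling c v σ live k) {y : Z} (hy : y ∈ live) (hv : v y = 1)
    (hσ : σ y ≠ y) : Filling c v (swap y (σ y) * σ) (live.erase y) k := by
  obtain ⟨α, p, q, f, S, T, hc, hd, hp, hq, hf, hn⟩ := h
  have hcard := Finset.card_erase_add_one hy
  by_cases hα : α y = y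
  · have hα' : α⁻¹ y = y := by rw [Perm.inv_eq_iff_eq, hα]
    obtain ⟨S', h1, h2⟩ := hp.erase_of_fixed hα
    have e : (σ * α⁻¹) y = σ y := by rw [Perm.mul_apply, hα']
    have h3 := hq.detach (y := y) (by rwa [e])
    rw [e] at h3
    refine ⟨α, _, _, f, S', T, hc, fun z hz => ?_, h1, by rwa [mul_assoc],
      fun z hz => ?_, by omega⟩
    · by_cases hzy : z = y
      · subst hzy; simp [hα]
      · have := hd z (fun h => hz (Finset.mem_erase.2 ⟨hzy, h⟩))
        simp [Function.update_of_ne hzy, this]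
    · by_cases hzy : z = y
      · subst hzy; simp at hz
      · rw [Function.update_of_ne hzy] at hz
        exact hf z hz
  · obtain ⟨q', T', h1, h2, h3⟩ := hq.mul_swap y (α y)
    have e : (σ * α⁻¹ * swap y (α y)) y = σ y := by simp
    have h4 := h1.detach (y := y) (by rw [e]; exact hσ)
    rw [e] at h4
    refine ⟨swap y (α y) * α, _, Function.update q' y none, f, S, T', fun z => ?_, fun z hz => ?_, hp.detach hα, ?_,
      fun z hz => ?_, by omega⟩
    · rw [Perm.mul_apply]
      by_cases h5 : α z = y
      · rw [h5, swap_apply_left, hc, ← h5, hc]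
      · by_cases h6 : α z = α y
        · rw [h6, swap_apply_right]; rw [α.injective h6]
        · rw [swap_apply_of_ne_of_ne h5 h6, hc]
    · by_cases hzy : z = y
      · subst hzy; simp
      · have := hd z (fun h => hz (Finset.mem_erase.2 ⟨hzy, h⟩))
        have h6 : z ≠ α y := fun e => hzy (α.injective (this.1.trans e))
        simp [Function.update_of_ne hzy, this, swap_apply_of_ne_of_ne hzy h6, h3]
    · simpa [mul_assoc] using h4
    · by_cases hzy : z = y
      · subst hzy; simp at hz
      · rw [Function.update_of_ne hzy] at hz
        rw [Perm.mul_apply]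
        by_cases h5 : α z = y
        · have : p y ≠ none := by rwa [← h5, hp.1]
          rw [h5, swap_apply_left, hf y this, ← h5, hf z hz, h5, hv, mul_one]
        · rw [swap_apply_of_ne_of_ne h5 (fun e => hzy (α.injective e)), hf z hz]

theorem Filling.merge (h : Filling c v σ live k) {x y : Z} (hx : x ∈ live) (hy : y ∈ live)
    (hxy : x ≠ y) (hσ : σ x = y) (hcxy : c x = c y) :
    Filling c (Function.update v y (v x * v y)) (swap x y * σ) (live.erase x) k := by
  have hcard := Finset.card_erase_add_one hx
  -- At the price of one label, `y` may be assumed to follow `x` under `α` as it does under `σ`; it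
  -- is then an unlabelled fixed point of `σ * α⁻¹`.
  have : ∃ (α : Perm Z) (p q : Z → Option ℕ) (f : Z → G) (S T : Finset ℕ),
      (∀ z, c (α z) = c z) ∧ (∀ z, z ∉ live → α z = z ∧ p z = none ∧ q z = none) ∧
      IsLabelling α p S ∧ IsLabelling (σ * α⁻¹) q T ∧ IsPotential α p v f ∧
      live.card + 2 ≤ S.card + T.card + 1 + k ∧ α x = y ∧ q y = none := by
    obtain ⟨α, p, q, f, S, T, hc, hd, hp, hq, hf, hn⟩ := h
    by_cases hα : α x = y
    · have hα' : α⁻¹ y = x := by rw [Perm.inv_eq_iff_eq, hα]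
      obtain ⟨T', h1, h2⟩ := hq.erase_of_fixed (y := y) (by rw [Perm.mul_apply, hα', hσ])
      refine ⟨α, p, _, f, S, T', hc, fun z hz => ?_, hp, h1, hf, by omega, hα, by simp⟩
      have hzy : z ≠ y := by rintro rfl; exact hz hy
      simpa [Function.update_of_ne hzy] using hd z hz
    · obtain ⟨p', S', f', h1, h2, h3, h4⟩ := hf.mul_swap hp x (α⁻¹ y)
      have hβ : (σ * α⁻¹) y ≠ y := by
        intro e
        rw [Perm.mul_apply] at e
        nth_rewrite 2 [← hσ] at e
        apply hα
        rw [← σ.injective e]; simp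
      have h5 := hq.detach hβ
      refine ⟨_, p', Function.update q y none, f', S', T, fun z => ?_, fun z hz => ?_, h1, ?_, h2, by omega, by simp,
        Function.update_self ..⟩
      · rw [Perm.mul_apply]
        by_cases hzx : z = x
        · subst hzx; simp [hcxy]
        · by_cases hzy : z = α⁻¹ y
          · have : c y = c z := by rw [← hc z, hzy]; simp
            rw [hzy, swap_apply_right, hc, hcxy, this, hzy]
          · rw [swap_apply_of_ne_of_ne hzx hzy, hc]
      · have hzx : z ≠ x := by rintro rfl; exact hz hx
        have hzy : z ≠ y := by rintro rfl; exact hz hy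
        have h6 : z ≠ α⁻¹ y := by
          intro e
          rw [eq_comm, Perm.inv_eq_iff_eq, (hd z hz).1] at e
          exact hzy e.symm
        rw [Perm.mul_apply, swap_apply_of_ne_of_ne hzx h6, Function.update_of_ne hzy]
        exact ⟨(hd z hz).1, h4 z (hd z hz).2.1, (hd z hz).2.2⟩
      · convert h5 using 1
        have : swap y ((σ * α⁻¹) y) = σ * swap x (α⁻¹ y) * σ⁻¹ := by
          rw [← Equiv.swap_apply_apply, hσ, Perm.mul_apply]
        rw [this, mul_inv_rev, swap_inv]
        group
  obtain ⟨α, p, q, f, S, T, hc, hd, hp, hq, hf, hn, hα, hqy⟩ := this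
  have h1 := hp.detach (y := x) (by rw [hα]; exact hxy.symm)
  rw [hα] at h1
  -- Multiplying both `σ` and `α` by `swap x y` conjugates `σ * α⁻¹`, hence `q ∘ swap x y`; its
  -- value at the discarded `x` is `q y = none`.
  refine ⟨swap x y * α, _, q ∘ swap x y, Function.update f y (f x), S, T, fun z => ?_,
    fun z hz => ?_, h1, ⟨fun z => ?_, fun m hm => ?_⟩, fun z hz => ?_, by omega⟩
  · rw [Perm.mul_apply]
    by_cases h5 : α z = x
    · rw [h5, swap_apply_left, ← hcxy, ← h5, hc]
    · by_cases h6 : α z = y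
      · rw [h6, swap_apply_right, hcxy, ← h6, hc]
      · rw [swap_apply_of_ne_of_ne h5 h6, hc]
  · by_cases hzx : z = x
    · subst hzx; simp [hα, hqy]
    · have hl : z ∉ live := fun h => hz (Finset.mem_erase.2 ⟨hzx, h⟩)
      have hzy : z ≠ y := by rintro rfl; exact hl hy
      simp [Function.update_of_ne hzx, swap_apply_of_ne_of_ne hzx hzy, hd z hl]
  · have := hq.1 (swap x y z)
    simpa using this
  · obtain ⟨z, hz⟩ := hq.2 m hm
    exact ⟨swap x y z, by simpa using hz⟩
  · by_cases hzx : z = x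
    · subst hzx; simp at hz
    rw [Function.update_of_ne hzx] at hz
    have hzα : α z ≠ y := fun e => hzx (α.injective (e.trans hα.symm))
    by_cases hzy : z = y
    · subst hzy
      have hpx : p x ≠ none := by rwa [← hp.1 x, hα]
      have e1 : f (α z) = f x * (v x * v z) := by
        rw [hf z hz, ← mul_assoc, ← hf x hpx, hα]
      by_cases h5 : α z = x
      · rw [h5] at e1
        simp only [Perm.mul_apply, h5, swap_apply_left, Function.update_self]
        exact e1
      · rw [Perm.mul_apply, swap_apply_of_ne_of_ne h5 hzα, Function.update_of_ne hzα, e1]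
        simp
    · by_cases h5 : α z = x
      · simp only [Perm.mul_apply, h5, swap_apply_left, Function.update_self,
          Function.update_of_ne hzy]
        rw [← h5, hf z hz]
      · rw [Perm.mul_apply, swap_apply_of_ne_of_ne h5 hzα]
        simp [Function.update_of_ne hzα, Function.update_of_ne hzy, hf z hz]

end Fillings

/-! ### Surfaces with boundary circles given as cyclic words -/

section Circles

variable {Z I G : Type*} [DecidableEq Z] [Group G]

theorem prod_map_formPerm_apply_of_notMem {C : List (List Z)} {z : Z} (hz : z ∉ C.flatten) :
    (C.map List.formPerm).prod z = z := by
  induction C with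
  | nil => rfl
  | cons l C ih =>
    rw [List.flatten_cons, List.mem_append, not_or] at hz
    rw [List.map_cons, List.prod_cons, Perm.mul_apply, ih hz.2,
      List.formPerm_apply_of_notMem hz.1]

theorem prod_map_formPerm_apply_of_mem {C : List (List Z)} (hC : C.flatten.Nodup) {l : List Z}
    (hl : l ∈ C) {z : Z} (hz : z ∈ l) : (C.map List.formPerm).prod z = l.formPerm z := by
  induction C with
  | nil => simp at hl
  | cons l' C ih =>
    rw [List.flatten_cons, List.nodup_append'] at hC
    rw [List.map_cons, List.prod_cons, Perm.mul_apply]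
    rcases List.mem_cons.1 hl with rfl | hl
    · rw [prod_map_formPerm_apply_of_notMem (hC.2.2 hz)]
    · rw [ih hC.2.1 hl, List.formPerm_apply_of_notMem]
      intro h
      exact hC.2.2 h (List.mem_flatten.2 ⟨l, hl, List.formPerm_apply_mem_of_mem hz⟩)

/-- A filling of disjoint boundary circles, each given by the cyclic list of its letters. -/
def CircleFilling (c : Z → I) (v : Z → G) (C : List (List Z)) : Prop :=
  C.flatten.Nodup ∧ Filling c v (C.map List.formPerm).prod C.flatten.toFinset C.length

variable {c : Z → I} {v : Z → G}

theorem CircleFilling.perm {C C' : List (List Z)} (h : CircleFilling c v C) (hp : C.Perm C') :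
    CircleFilling c v C' := by
  have hf : C.flatten.Perm C'.flatten := hp.flatten
  have hn : C'.flatten.Nodup := hf.nodup_iff.1 h.1
  refine ⟨hn, ?_⟩
  have e : (C.map List.formPerm).prod = (C'.map List.formPerm).prod := by
    ext z
    by_cases hz : z ∈ C.flatten
    · obtain ⟨l, hl, hz⟩ := List.mem_flatten.1 hz
      rw [prod_map_formPerm_apply_of_mem h.1 hl hz,
        prod_map_formPerm_apply_of_mem hn (hp.mem_iff.1 hl) hz]
    · rw [prod_map_formPerm_apply_of_notMem hz,
        prod_map_formPerm_apply_of_notMem (fun h' => hz (hf.mem_iff.2 h'))]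
  rw [← e, ← hp.length_eq, ← List.toFinset_eq_of_perm _ _ hf]
  exact h.2

theorem CircleFilling.rotate {C : List (List Z)} {l l' : List Z} (h : CircleFilling c v (l :: C))
    (hl : l ~r l') : CircleFilling c v (l' :: C) := by
  have hn := h.1
  rw [List.flatten_cons] at hn
  have hp : (l ++ C.flatten).Perm (l' ++ C.flatten) := hl.perm.append_right _
  refine ⟨by rw [List.flatten_cons]; exact hp.nodup_iff.1 hn, ?_⟩
  have h2 := h.2
  rw [List.flatten_cons, List.toFinset_eq_of_perm _ _ hp, List.map_cons,
    List.formPerm_eq_of_isRotated hn.of_append_left hl] at h2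
  exact h2

theorem formPerm_append_cons_cons (l : List Z) (a b : Z) (m : List Z) :
    (l ++ a :: b :: m).formPerm = (l ++ [a]).formPerm * (swap a b * (b :: m).formPerm) := by
  induction l with
  | nil => simp
  | cons x l ih =>
    cases l with
    | nil => simp [List.formPerm_cons_cons]
    | cons y l =>
      simp only [List.cons_append, List.formPerm_cons_cons] at ih ⊢
      rw [ih, mul_assoc]

/-- Exchanging the successors of the last entries of `p` and `q` closes up each list separately. -/
theorem exists_formPerm_append_mul_swap {p q : List Z} (h : (p ++ q).Nodup) (hp : p ≠ [])
    (hq : q ≠ []) :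
    ∃ a ∈ p, ∃ b ∈ q, (p ++ q).formPerm * swap a b = p.formPerm * q.formPerm := by
  obtain ⟨l, a, rfl⟩ : ∃ l a, p = l ++ [a] :=
    ⟨_, _, (List.dropLast_append_getLast hp).symm⟩
  obtain ⟨b, m, rfl⟩ := List.exists_cons_of_ne_nil hq
  refine ⟨a, by simp, (b :: m).getLast hq, List.getLast_mem hq, ?_⟩
  have ha : a ∉ b :: m := fun h' => (List.nodup_append'.1 h).2.2 (by simp) h'
  rw [List.append_assoc, List.singleton_append, formPerm_append_cons_cons]
  have e : (b :: m).formPerm * swap a ((b :: m).getLast hq) =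
      swap a b * (b :: m).formPerm := by
    rw [Equiv.mul_swap_eq_swap_mul, List.formPerm_apply_of_notMem ha,
      List.formPerm_apply_getLast]
  rw [mul_assoc, mul_assoc, e, ← mul_assoc (swap a b), swap_mul_self, one_mul]

theorem CircleFilling.cut {C : List (List Z)} {p q : List Z}
    (h : CircleFilling c v ((p ++ q) :: C)) (hp : p ≠ []) (hq : q ≠ []) :
    CircleFilling c v (p :: q :: C) := by
  have hn := h.1
  rw [List.flatten_cons] at hn
  obtain ⟨a, ha, b, hb, e⟩ := exists_formPerm_append_mul_swap hn.of_append_left hp hq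
  have h2 := h.2.cut a b
  have hd := (List.nodup_append'.1 hn).2.2
  have hρ : (C.map List.formPerm).prod * swap a b = swap a b * (C.map List.formPerm).prod := by
    rw [Equiv.mul_swap_eq_swap_mul,
      prod_map_formPerm_apply_of_notMem (hd (List.mem_append_left _ ha)),
      prod_map_formPerm_apply_of_notMem (hd (List.mem_append_right _ hb))]
  rw [List.map_cons, List.prod_cons, mul_assoc, hρ, ← mul_assoc, e, mul_assoc] at h2
  refine ⟨by simpa [List.append_assoc] using hn, ?_⟩
  simpa [List.append_assoc] using h2

/-- `Filling.merge` turns the pair into one trivial letter, which `Filling.kill` removes; nonempty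
`l` keeps the circle from vanishing. -/
theorem CircleFilling.cancel {C : List (List Z)} {x y : Z} {l : List Z}
    (h : CircleFilling c v ((x :: y :: l) :: C)) (hl : l ≠ []) (hc : c x = c y)
    (hv : v x * v y = 1) : CircleFilling c v (l :: C) := by
  obtain ⟨hn, h2⟩ := h
  obtain ⟨w, m, rfl⟩ := List.exists_cons_of_ne_nil hl
  have hx : x ∉ (y :: w :: m) ++ C.flatten := (List.nodup_cons.1 hn).1
  have hn' : ((y :: w :: m) ++ C.flatten).Nodup := (List.nodup_cons.1 hn).2
  have hy : y ∉ (w :: m) ++ C.flatten := (List.nodup_cons.1 hn').1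
  have hxy : x ≠ y := by rintro rfl; simp at hx
  have hyw : y ≠ w := by rintro rfl; simp at hy
  have ex : (((x :: y :: w :: m) :: C).map List.formPerm).prod x = y := by
    rw [prod_map_formPerm_apply_of_mem hn (l := x :: y :: w :: m) (by simp) (by simp),
      List.formPerm_apply_head _ _ _ (List.Nodup.of_append_left hn)]
  have h3 := h2.merge (x := x) (y := y) (by simp) (by simp) hxy ex hc
  have e1 : swap x y * (((x :: y :: w :: m) :: C).map List.formPerm).prod =
      (((y :: w :: m) :: C).map List.formPerm).prod := by
    simp only [List.map_cons, List.prod_cons, List.formPerm_cons_cons x y]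
    rw [← mul_assoc, ← mul_assoc, swap_mul_self, one_mul]
  have e2 : ((x :: y :: w :: m) :: C).flatten.toFinset.erase x =
      ((y :: w :: m) :: C).flatten.toFinset := by
    rw [show ((x :: y :: w :: m) :: C).flatten = x :: ((y :: w :: m) ++ C.flatten) from rfl,
      List.toFinset_cons, Finset.erase_insert (by simpa using hx)]
    rfl
  rw [e1, e2, hv] at h3
  have ey : (((y :: w :: m) :: C).map List.formPerm).prod y = w := by
    rw [prod_map_formPerm_apply_of_mem (C := (y :: w :: m) :: C) hn' (l := y :: w :: m) (by simp) (by simp),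
      List.formPerm_apply_head _ _ _ (List.Nodup.of_append_left hn')]
  have h4 := h3.kill (y := y) (by simp) (by simp) (by rw [ey]; exact hyw.symm)
  have e3 : swap y w * (((y :: w :: m) :: C).map List.formPerm).prod =
      (((w :: m) :: C).map List.formPerm).prod := by
    simp only [List.map_cons, List.prod_cons, List.formPerm_cons_cons y w]
    rw [← mul_assoc, ← mul_assoc, swap_mul_self, one_mul]
  have e4 : ((y :: w :: m) :: C).flatten.toFinset.erase y =
      ((w :: m) :: C).flatten.toFinset := by
    rw [show ((y :: w :: m) :: C).flatten = y :: ((w :: m) ++ C.flatten) from rfl,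
      List.toFinset_cons, Finset.erase_insert (by simpa using hy)]
    rfl
  rw [ey, e3, e4] at h4
  refine ⟨(List.nodup_cons.1 hn').2, Filling.congr h4 fun z hz => ?_⟩
  rw [Function.update_of_ne]
  rintro rfl
  exact hy (by simpa using hz)

/-- `U'` spells the inverse of `U`, letter by letter, in reverse order. -/
def IsInverseList (c : Z → I) (v : Z → G) : List Z → List Z → Prop
  | U, U' => List.Forall₂ (fun x y => c x = c y ∧ v x * v y = 1) U U'.reverse

/-- Rotating the first letter of `U` to the end leaves a shorter conjugator. After the inductive cut
this letter and its inverse are adjacent on the other circle and cancel, which `r` survives. -/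
theorem CircleFilling.cut_conj {C : List (List Z)} {w : List Z} (hw : w ≠ []) (U U' : List Z)
    (hU : IsInverseList c v U U') {r : List Z} (hr : r ≠ [])
    (h : CircleFilling c v ((U ++ w ++ U' ++ r) :: C)) : CircleFilling c v (w :: r :: C) := by
  induction U generalizing U' r with
  | nil =>
    have : U' = [] := by simpa [IsInverseList] using hU
    subst this
    exact CircleFilling.cut (by simpa using h) hw hr
  | cons x U ih =>
    obtain ⟨y, V, ⟨hc, hv⟩, hV, e⟩ := List.forall₂_cons_left_iff.1 hU
    obtain rfl : U' = V.reverse ++ [y] := by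
      rw [← List.reverse_reverse U', e, List.reverse_cons]
    have h1 : CircleFilling c v ((U ++ w ++ V.reverse ++ (y :: r ++ [x])) :: C) := by
      refine h.rotate ⟨1, ?_⟩
      simp
    have h2 := ih V.reverse (by simpa [IsInverseList] using hV) (by simp) h1
    have h3 : CircleFilling c v ((y :: r ++ [x]) :: w :: C) := h2.perm (List.Perm.swap ..)
    have h4 : CircleFilling c v ((x :: y :: r) :: w :: C) := by
      refine h3.rotate (List.IsRotated.symm ⟨1, by simp⟩)
    exact (h4.cancel hr hc hv).perm (List.Perm.swap ..)

end Circles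

/-! ### Building discs letter by letter -/

section Discs

variable {Z I G : Type*} [DecidableEq Z] [Group G]
variable {c : Z → I} {v : Z → G} {σ : Perm Z} {live : Finset Z} {k : ℕ}

theorem IsLabelling.insert_fixed {γ : Perm Z} {p : Z → Option ℕ} {S : Finset ℕ}
    (h : IsLabelling γ p S) {x : Z} (hx : γ x = x) (hpx : p x = none) :
    ∃ m S', IsLabelling γ (Function.update p x (some m)) S' ∧ S'.card = S.card + 1 := by
  obtain ⟨m, hm⟩ := Infinite.exists_notMem_finset S
  refine ⟨m, insert m S, ⟨fun z => ?_, fun m' hm' => ?_⟩, Finset.card_insert_of_notMem hm⟩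
  · by_cases hz : z = x
    · rw [hz, hx]
    · have : γ z ≠ x := fun e => hz (γ.injective (e.trans hx.symm))
      simp [Function.update_of_ne hz, Function.update_of_ne this, h.1]
  · rcases Finset.mem_insert.1 hm' with rfl | hm'
    · exact ⟨x, Function.update_self ..⟩
    · obtain ⟨z, hz⟩ := h.2 m' hm'
      exact ⟨z, by rw [Function.update_of_ne, hz]; rintro rfl; simp [hpx] at hz⟩

theorem IsLabelling.insert_swap {γ : Perm Z} {p : Z → Option ℕ} {S : Finset ℕ}
    (h : IsLabelling γ p S) {x y : Z} (hxy : x ≠ y) (hx : γ x = x) (hpx : p x = none) :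
    IsLabelling (swap x y * γ) (Function.update p x (p y)) S := by
  refine ⟨fun z => ?_, fun m hm => ?_⟩
  · by_cases hz : z = x
    · subst hz; simp [hx, Function.update_of_ne hxy.symm]
    · have h1 : γ z ≠ x := fun e => hz (γ.injective (e.trans hx.symm))
      by_cases h2 : γ z = y
      · have : p y = p z := by rw [← h2, h.1]
        simp [h2, Function.update_of_ne hz, this]
      · simp [swap_apply_of_ne_of_ne h1 h2, Function.update_of_ne hz, Function.update_of_ne h1, h.1]
  · obtain ⟨z, hz⟩ := h.2 m hm
    exact ⟨z, by rw [Function.update_of_ne, hz]; rintro rfl; simp [hpx] at hz⟩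

/-- Converse of `Filling.kill`: `x` is a one-point cycle of `α`, whose fresh label pays for the new
point. -/
theorem Filling.insert_trivial (h : Filling c v σ live k) {x y : Z} (hx : x ∉ live)
    (hy : y ∈ live) (hσ : σ x = x) (hv : v x = 1) :
    Filling c v (swap x y * σ) (insert x live) k := by
  obtain ⟨α, p, q, f, S, T, hc, hd, hp, hq, hf, hn⟩ := h
  have hxy : x ≠ y := by rintro rfl; exact hx hy
  obtain ⟨hα, hpx, hqx⟩ := hd x hx
  obtain ⟨m, S', h1, h2⟩ := hp.insert_fixed hα hpx
  have hα' : α⁻¹ x = x := by rw [Perm.inv_eq_iff_eq, hα]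
  have h3 := hq.insert_swap hxy (by rw [Perm.mul_apply, hα', hσ]) hqx
  refine ⟨α, _, Function.update q x (q y), f, S', T, hc, fun z hz => ?_, h1,
    by rwa [mul_assoc], fun z hz => ?_, ?_⟩
  · rw [Finset.mem_insert, not_or] at hz
    simpa [Function.update_of_ne hz.1] using hd z hz.2
  · by_cases hzx : z = x
    · subst hzx; rw [hα, hv, mul_one]
    · rw [Function.update_of_ne hzx] at hz
      exact hf z hz
  · rw [Finset.card_insert_of_notMem hx]; omega

/-- Converse of `Filling.merge`: `x` is put before `y` under both `σ` and `α`, so `y` becomes a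
fixed point of `σ * α⁻¹` and takes a fresh label. -/
theorem Filling.split {x y : Z}
    (h : Filling c (Function.update v y (v x * v y)) σ live k) (hx : x ∉ live)
    (hy : y ∈ live) (hσ : σ x = x) (hcxy : c x = c y) :
    Filling c v (swap x y * σ) (insert x live) k := by
  obtain ⟨α, p, q, f, S, T, hc, hd, hp, hq, hf, hn⟩ := h
  have hxy : x ≠ y := by rintro rfl; exact hx hy
  obtain ⟨hα, hpx, hqx⟩ := hd x hx
  have hα' : α⁻¹ x = x := by rw [Perm.inv_eq_iff_eq, hα]
  obtain ⟨m, T', h1, h2⟩ := hq.insert_fixed (by rw [Perm.mul_apply, hα', hσ]) hqx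
  refine ⟨swap x y * α, _, Function.update q x (some m) ∘ swap x y,
    Function.update (Function.update f y (f y * v x)) x (f y), S, T', fun z => ?_,
    fun z hz => ?_, hp.insert_swap hxy hα hpx, ⟨fun z => ?_, fun m' hm' => ?_⟩,
    fun z hz => ?_, ?_⟩
  · rw [Perm.mul_apply]
    by_cases h5 : α z = x
    · rw [h5, swap_apply_left, ← hcxy, ← h5, hc]
    · by_cases h6 : α z = y
      · rw [h6, swap_apply_right, hcxy, ← h6, hc]
      · rw [swap_apply_of_ne_of_ne h5 h6, hc]
  · rw [Finset.mem_insert, not_or] at hz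
    have hzy : z ≠ y := by rintro rfl; exact hz.2 hy
    simp [Function.update_of_ne hz.1, swap_apply_of_ne_of_ne hz.1 hzy, hd z hz.2]
  · simpa using h1.1 (swap x y z)
  · obtain ⟨z, hz⟩ := h1.2 m' hm'
    exact ⟨swap x y z, by simpa using hz⟩
  · by_cases hzx : z = x
    · subst hzx
      simp [hα, Function.update_of_ne hxy.symm]
    rw [Function.update_of_ne hzx] at hz
    have h5 : α z ≠ x := fun e => hzx (α.injective (e.trans hα.symm))
    have hfz := hf z hz
    by_cases hzy : z = y
    · subst hzy
      rw [Function.update_self, ← mul_assoc] at hfz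
      by_cases h6 : α z = z
      · rw [h6] at hfz
        simp only [Perm.mul_apply, h6, swap_apply_right, Function.update_self,
          Function.update_of_ne hzx]
        exact hfz
      · rw [Perm.mul_apply, swap_apply_of_ne_of_ne h5 h6, Function.update_of_ne h5,
          Function.update_of_ne h6, hfz, Function.update_of_ne hzx, Function.update_self]
    · rw [Function.update_of_ne hzy] at hfz
      by_cases h6 : α z = y
      · simp only [Perm.mul_apply, h6, swap_apply_right, Function.update_self,
          Function.update_of_ne hzx, Function.update_of_ne hzy]
        rw [← hfz, h6]
      · rw [Perm.mul_apply, swap_apply_of_ne_of_ne h5 h6, Function.update_of_ne h5,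
          Function.update_of_ne h6, hfz, Function.update_of_ne hzx, Function.update_of_ne hzy]
  · rw [Finset.card_insert_of_notMem hx]; omega

theorem circleFilling_singleton {x : Z} (hv : v x = 1) : CircleFilling c v [[x]] := by
  -- One labelled cycle for each permutation is just enough: `1 + 2 ≤ 1 + 1 + 1`.
  refine ⟨by simp, 1, Function.update (fun _ => none) x (some 0),
    Function.update (fun _ => none) x (some 0), fun _ => 1, {0}, {0}, by simp, fun z hz => ?_,
    ⟨by simp, ?_⟩, ⟨by simp, ?_⟩, fun z hz => ?_, by simp⟩
  · have : z ≠ x := by simpa using hz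
    simp [Function.update_of_ne this]
  · simpa using ⟨x, Function.update_self ..⟩
  · simpa using ⟨x, Function.update_self ..⟩
  · have : z = x := by
      by_contra hzx
      simp [Function.update_of_ne hzx] at hz
    simp [this, hv]

theorem CircleFilling.cons_trivial {x y : Z} {l : List Z} (h : CircleFilling c v [y :: l])
    (hx : x ∉ y :: l) (hv : v x = 1) : CircleFilling c v [x :: y :: l] := by
  have hn : (y :: l).Nodup := by simpa using h.1
  have h2 : Filling c v (y :: l).formPerm (y :: l).toFinset 1 := by simpa using h.2
  have h3 := h2.insert_trivial (x := x) (y := y) (by simpa using hx) (by simp)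
    (List.formPerm_apply_of_notMem hx) hv
  refine ⟨by simpa using And.intro (by simpa using hx) hn, ?_⟩
  simpa [List.formPerm_cons_cons] using h3

theorem CircleFilling.cons_split {x y : Z} {l : List Z}
    (h : CircleFilling c (Function.update v y (v x * v y)) [y :: l])
    (hx : x ∉ y :: l) (hc : c x = c y) : CircleFilling c v [x :: y :: l] := by
  have hn : (y :: l).Nodup := by simpa using h.1
  have h2 : Filling c (Function.update v y (v x * v y)) (y :: l).formPerm (y :: l).toFinset 1 := by
    simpa using h.2
  have h3 := h2.split (x := x) (y := y) (by simpa using hx) (by simp)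
    (List.formPerm_apply_of_notMem hx) hc
  refine ⟨by simpa using And.intro (by simpa using hx) hn, ?_⟩
  simpa [List.formPerm_cons_cons] using h3

end Discs

/-! ### Null-homotopic words in a free product bound discs -/

section FreeProducts

variable {Z I : Type*} {K : I → Type*} [∀ i, Group (K i)]

theorem eq_nil_of_prod_eq_one (l : List (Σ i, K i)) (h1 : ∀ a ∈ l, a.2 ≠ 1)
    (h2 : l.IsChain fun a b => a.1 ≠ b.1)
    (h : (l.map fun a => (CoprodI.of a.2 : CoprodI K)).prod = 1) : l = [] := by
  classical
  have e : (⟨l, h1, h2⟩ : CoprodI.Word K).prod = CoprodI.Word.empty.prod := by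
    rw [CoprodI.Word.prod_empty, ← h]; rfl
  exact congrArg CoprodI.Word.toList (CoprodI.Word.equiv.symm.injective
    (a₁ := ⟨l, h1, h2⟩) (a₂ := CoprodI.Word.empty) e)

theorem exists_reduction {c : Z → I} {v : Z → CoprodI K}
    (hv : ∀ z, v z ∈ (CoprodI.of : K (c z) →* CoprodI K).range) {l : List Z} (hl : l ≠ [])
    (h : (l.map v).prod = 1) :
    (∃ l₁ x l₂, l = l₁ ++ x :: l₂ ∧ v x = 1) ∨
      ∃ l₁ x y l₂, l = l₁ ++ x :: y :: l₂ ∧ c x = c y := by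
  by_contra! H
  choose a ha using hv
  have : l.map (fun z => (⟨c z, a z⟩ : Σ i, K i)) = [] := by
    apply eq_nil_of_prod_eq_one
    · intro b hb
      obtain ⟨z, hz, rfl⟩ := List.mem_map.1 hb
      obtain ⟨l₁, l₂, rfl⟩ := List.append_of_mem hz
      intro e
      exact H.1 l₁ z l₂ rfl (by rw [← ha z]; simp only at e; rw [e, map_one])
    · rw [List.isChain_map, List.isChain_iff_forall_rel_of_append_cons_cons]
      intro x y l₁ l₂ e
      exact H.2 l₁ x y l₂ e
    · simpa [Function.comp_def, ha] using h
  exact hl (by simpa using this)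

/-- A circle whose letters have trivial product in the free product bounds a disc. -/
theorem circleFilling_of_prod_eq_one [DecidableEq Z] {c : Z → I} (n : ℕ) {v : Z → CoprodI K}
    (hv : ∀ z, v z ∈ (CoprodI.of : K (c z) →* CoprodI K).range) {l : List Z}
    (hln : l.length = n + 1) (hn : l.Nodup) (h : (l.map v).prod = 1) : CircleFilling c v [l] := by
  induction n generalizing v l with
  | zero =>
    obtain ⟨x, rfl⟩ := List.length_eq_one_iff.1 hln
    exact circleFilling_singleton (by simpa using h)
  | succ n ih =>
    have hrot : ∀ l' : List Z, l' ~r l → (l'.map v).prod = 1 := by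
      rintro l' hl'
      obtain ⟨m, rfl⟩ := hl'.symm
      rw [List.map_rotate, List.prod_rotate_eq_one_of_prod_eq_one h]
    rcases exists_reduction hv (by rintro rfl; simp at hln) h with
      ⟨l₁, x, l₂, e, hx⟩ | ⟨l₁, x, y, l₂, e, hxy⟩
    · have hr : (x :: (l₂ ++ l₁)) ~r l := by
        rw [e]; exact List.isRotated_append (l := x :: l₂) (l' := l₁)
      have hp := hrot _ hr
      have hn' := hr.nodup_iff.2 hn
      have hlen := hr.perm.length_eq
      cases hm : l₂ ++ l₁ with
      | nil => rw [hm] at hlen; simp at hlen; omega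
      | cons y m =>
        rw [hm] at hp hn' hlen hr
        refine (CircleFilling.cons_trivial (ih hv ?_ (List.nodup_cons.1 hn').2 ?_)
          (List.nodup_cons.1 hn').1 hx).rotate hr
        · simp at hlen ⊢; omega
        · simpa [hx] using hp
    · have hr : (x :: y :: (l₂ ++ l₁)) ~r l := by
        rw [e]; exact List.isRotated_append (l := x :: y :: l₂) (l' := l₁)
      have hp := hrot _ hr
      have hn' := hr.nodup_iff.2 hn
      have hlen := hr.perm.length_eq
      refine (CircleFilling.cons_split (ih (fun z => ?_) ?_ (List.nodup_cons.1 hn').2 ?_)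
          (List.nodup_cons.1 hn').1 hxy).rotate hr
      · by_cases hz : z = y
        · subst hz
          rw [Function.update_self]
          exact mul_mem (hxy ▸ hv x) (hv z)
        · rw [Function.update_of_ne hz]; exact hv z
      · simp at hlen ⊢; omega
      · have hy : y ∉ l₂ ++ l₁ := (List.nodup_cons.1 (List.nodup_cons.1 hn').2).1
        rw [List.map_cons, List.map_congr_left (g := v), Function.update_self]
        · simpa [mul_assoc] using hp
        · intro z hz
          rw [Function.update_of_ne]
          rintro rfl
          exact hy hz

end FreeProducts

/-! ### Counting cycles by drops in position -/

section Costs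

variable {Z I G : Type*} [DecidableEq Z] [Group G]
variable {c : Z → I} {v : Z → G} {σ : Perm Z} {live : Finset Z} {k L : ℕ} [NeZero L]

/-- These are the costs of the `α`-step from `z` and of the `σ * α⁻¹`-step from `α z`. -/
theorem ZMod.val_add_val_neg_sub_one (d : ZMod L) : d.val + (-d - 1).val = L - 1 := by
  have hd := d.val_lt
  have : -d - 1 = ((L - 1 - d.val : ℕ) : ZMod L) := by
    rw [Nat.cast_sub (by omega), Nat.cast_sub (by omega)]
    simp
    ring
  rw [this, ZMod.val_cast_of_lt (by omega)]
  omega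

/-- Over a label class the drops telescope to 0 modulo `L`, so their residues sum to a multiple of
`L`, positive once the position changes somewhere. -/
theorem IsLabelling.mul_card_le {γ : Perm Z} {q : Z → Option ℕ} {T : Finset ℕ}
    (h : IsLabelling γ q T) (hd : ∀ z, z ∉ live → γ z = z ∧ q z = none) (pos : Z → ZMod L)
    (hne : ∀ z, q z ≠ none → ∃ w, q w = q z ∧ pos (γ w) ≠ pos w) :
    L * T.card ≤ ∑ z ∈ live, (pos z - pos (γ z)).val := by
  have hlive : ∀ z, γ z ∈ live ↔ z ∈ live := by
    refine fun z => ⟨fun h1 => ?_, fun h1 => ?_⟩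
    · by_contra h2
      rw [(hd z h2).1] at h1
      exact h2 h1
    · by_contra h2
      rw [γ.injective (hd _ h2).1] at h2
      exact h2 h1
  have hfib : ∀ m ∈ T, L ≤ ∑ z ∈ live with q z = some m, (pos z - pos (γ z)).val := by
    intro m hm
    obtain ⟨z, hz⟩ := h.2 m hm
    obtain ⟨w, hw, hpos⟩ := hne z (by simp [hz])
    have hwl : w ∈ live := by
      by_contra h2
      rw [(hd w h2).2, hz] at hw
      simp at hw
    refine Nat.le_of_dvd ?_ ?_
    · refine Finset.sum_pos' (fun _ _ => Nat.zero_le _) ⟨w, by simp [hwl, hw, hz], ?_⟩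
      rw [Nat.pos_iff_ne_zero, Ne, ZMod.val_eq_zero, sub_eq_zero]
      exact hpos.symm
    · rw [← ZMod.natCast_eq_zero_iff, Nat.cast_sum]
      simp only [ZMod.natCast_val, ZMod.cast_id', id_eq]
      rw [Finset.sum_sub_distrib, sub_eq_zero]
      exact (Finset.sum_equiv γ (by simp [hlive, h.1]) (fun _ _ => rfl)).symm
  calc L * T.card = ∑ m ∈ T, L := by simp [mul_comm]
    _ ≤ ∑ m ∈ T, ∑ z ∈ live with q z = some m, (pos z - pos (γ z)).val :=
      Finset.sum_le_sum hfib
    _ = ∑ z ∈ live, ∑ m ∈ T, if q z = some m then (pos z - pos (γ z)).val else 0 := by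
      rw [Finset.sum_comm]
      simp only [Finset.sum_filter]
    _ ≤ ∑ z ∈ live, (pos z - pos (γ z)).val := by
      refine Finset.sum_le_sum fun z _ => ?_
      cases q z with
      | none => simp
      | some m =>
        simp only [Option.some.injEq, Finset.sum_ite_eq]
        split_ifs <;> simp

/-- A planar surface cannot have all its boundary circles equal to one cyclically reduced word
of length `L` whose letters have infinite order. -/
theorem Filling.false_of_card_eq (h : Filling c v σ live k) (hk : live.card = k * L)
    (pos : Z → ZMod L) (C : ZMod L → I) (X : ZMod L → G)
    (hσ : ∀ z ∈ live, pos (σ z) = pos z + 1) (hσl : ∀ z ∉ live, σ z = z)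
    (hc : ∀ z ∈ live, c z = C (pos z)) (hC : ∀ j, C j ≠ C (j + 1))
    (hv : ∀ z ∈ live, v z = X (pos z)) (hX : ∀ j, Function.Injective fun n : ℕ => X j ^ n) :
    False := by
  obtain ⟨α, p, q, f, S, T, hcα, hd, hp, hq, hf, hn⟩ := h
  have hαl : ∀ z, α z ∈ live ↔ z ∈ live := by
    refine fun z => ⟨fun h1 => ?_, fun h1 => ?_⟩
    · by_contra h2
      rw [(hd z h2).1] at h1
      exact h2 h1
    · by_contra h2
      rw [α.injective (hd _ h2).1] at h2
      exact h2 h1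
  have hlive : ∀ z, p z ≠ none → z ∈ live := fun z hz => by
    by_contra h2
    exact hz (hd z h2).2.1
  have h1 : L * S.card ≤ ∑ z ∈ live, (pos z - pos (α z)).val := by
    refine hp.mul_card_le (fun z hz => ⟨(hd z hz).1, (hd z hz).2.1⟩) pos fun z hz => ?_
    by_contra! H
    -- With constant position each step multiplies `f` by the same letter; the orbit is finite, so
    -- two powers of that letter agree.
    have key : ∀ i : ℕ, p ((α ^ i) z) = p z ∧ pos ((α ^ i) z) = pos z ∧
        f ((α ^ i) z) = f z * X (pos z) ^ i := by
      intro i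
      induction i with
      | zero => simp
      | succ i ih =>
        have hne : p ((α ^ i) z) ≠ none := by rwa [ih.1]
        rw [pow_succ', Perm.mul_apply, hp.1, H _ ih.1, hf _ hne, hv _ (hlive _ hne), ih.2.1,
          ih.2.2, pow_succ, mul_assoc]
        exact ⟨ih.1, rfl, rfl⟩
    refine not_injective_infinite_finite
      (fun i : ℕ => (⟨(α ^ i) z, hlive _ (by rwa [(key i).1])⟩ : live)) fun i j hij => ?_
    have e : (α ^ i) z = (α ^ j) z := congrArg Subtype.val hij
    have := (key i).2.2
    rw [e, (key j).2.2] at this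
    exact (hX _ (mul_left_cancel this)).symm
  have h2 : L * T.card ≤ ∑ z ∈ live, (pos z - pos ((σ * α⁻¹) z)).val := by
    refine hq.mul_card_le (fun z hz => ⟨?_, (hd z hz).2.2⟩) pos fun z hz => ⟨z, rfl, ?_⟩
    · rw [Perm.mul_apply, Perm.inv_eq_iff_eq.2 (hd z hz).1.symm, hσl z hz]
    · have hz : z ∈ live := by
        by_contra h2
        exact hz (hd z h2).2.2
      obtain ⟨w, rfl⟩ := α.surjective z
      have hw := (hαl w).1 hz
      -- If `pos (α w) = pos w + 1`, neighbouring letters of the word share a factor, since `α`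
      -- preserves colours.
      rw [Perm.mul_apply, show α⁻¹ (α _) = _ from α.symm_apply_apply _, hσ w hw]
      intro e
      apply hC (pos w)
      rw [e, ← hc _ hz, hcα, hc w hw]
  have h3 : ∑ z ∈ live, (pos z - pos ((σ * α⁻¹) z)).val =
      ∑ z ∈ live, (-(pos z - pos (α z)) - 1).val := by
    refine (Finset.sum_equiv α (by simp [hαl]) fun z hz => ?_).symm
    rw [Perm.mul_apply, show α⁻¹ (α _) = _ from α.symm_apply_apply _, hσ z hz]
    congr 1
    ring
  have h4 : ∑ z ∈ live, (pos z - pos (α z)).val + ∑ z ∈ live, (-(pos z - pos (α z)) - 1).val =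
      live.card * (L - 1) := by
    rw [← Finset.sum_add_distrib]
    simp only [ZMod.val_add_val_neg_sub_one, Finset.sum_const, smul_eq_mul]
  have h5 : L * (S.card + T.card) ≤ k * (L - 1) * L := by
    calc L * (S.card + T.card) = L * S.card + L * T.card := by ring
      _ ≤ live.card * (L - 1) := by rw [← h4, ← h3]; exact add_le_add h1 h2
      _ = k * (L - 1) * L := by rw [hk]; ring
  rw [mul_comm] at h5
  have hL : 0 < L := Nat.pos_of_ne_zero (NeZero.ne L)
  have h6 : S.card + T.card ≤ k * (L - 1) := Nat.le_of_mul_le_mul_right h5 hL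
  have h7 : k * (L - 1) + k = k * L := by
    obtain ⟨m, rfl⟩ : ∃ m, L = m + 1 := ⟨L - 1, by omega⟩
    simp; ring
  omega

end Costs

/-! ### Cyclically reduced words -/

theorem IsInverseList.prod_eq_inv {Z I G : Type*} [Group G] {c : Z → I} {v : Z → G}
    {U U' : List Z} (h : IsInverseList c v U U') : (U'.map v).prod = (U.map v).prod⁻¹ := by
  obtain ⟨R, rfl⟩ : ∃ R, U' = R.reverse := ⟨U'.reverse, by simp⟩
  rw [IsInverseList, List.reverse_reverse] at h
  induction h with
  | nil => simp
  | @cons _ _ l₁ _ h _ ih =>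
    rw [List.reverse_cons, List.map_append, List.prod_append, ih, List.map_cons (l := l₁),
      List.prod_cons, mul_inv_rev, ← eq_inv_of_mul_eq_one_right h.2]
    simp

theorem map_range_getD {α : Type*} (l : List α) (d : α) :
    (List.range l.length).map (fun j => l.getD j d) = l :=
  List.ext_getElem (by simp) (by simp +contextual)

section

variable {I : Type*} {K : I → Type*} [∀ i, Group (K i)]

theorem exists_letters (g : CoprodI K) :
    ∃ l : List (Σ i, K i), (l.map fun a => (CoprodI.of a.2 : CoprodI K)).prod = g := by
  induction g using CoprodI.induction_left with
  | one => exact ⟨[], rfl⟩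
  | mul m x ih =>
    obtain ⟨l, rfl⟩ := ih
    exact ⟨⟨_, m⟩ :: l, rfl⟩

/-- The last factor `W` has no conjugator: it is the nonempty remainder from which the other circles
are cut off. -/
theorem false_of_prod_conj_mul_eq_one (hK : ∀ i, GenTorsion.TorsionFree (K i)) {L : ℕ} [NeZero L]
    (x : ZMod L → Σ i, K i) (hx1 : ∀ j, (x j).2 ≠ 1) (hxc : ∀ j, (x j).1 ≠ (x (j + 1)).1)
    (n : ℕ) (u : ℕ → CoprodI K) (W : CoprodI K)
    (hW : ((List.range L).map fun j : ℕ => (CoprodI.of (x j).2 : CoprodI K)).prod = W)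
    (h : ((List.range n).map fun b => u b * W * (u b)⁻¹).prod * W = 1) : False := by
  choose U hU using fun b => exists_letters (u b)
  -- `inl (b, j)` is letter `j` of copy `b` of `W`; `inr (b, j, s)` is letter `j` of a word for `u
  -- b`, inverted if `s` is true. The default `x 0` is never read at the points used.
  let a : (ℕ × ℕ) ⊕ (ℕ × ℕ × Bool) → Σ i, K i := fun z => match z with
    | .inl z => x z.2
    | .inr (b, j, false) => (U b).getD j (x 0)
    | .inr (b, j, true) => ⟨((U b).getD j (x 0)).1, ((U b).getD j (x 0)).2⁻¹⟩
  let c : (ℕ × ℕ) ⊕ (ℕ × ℕ × Bool) → I := fun z => (a z).1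
  let v : (ℕ × ℕ) ⊕ (ℕ × ℕ × Bool) → CoprodI K := fun z => CoprodI.of (a z).2
  let wl : ℕ → List ((ℕ × ℕ) ⊕ (ℕ × ℕ × Bool)) := fun b =>
    (List.range L).map fun j => .inl (b, j)
  let tl : Bool → ℕ → List ((ℕ × ℕ) ⊕ (ℕ × ℕ × Bool)) := fun s b =>
    (List.range (U b).length).map fun j => .inr (b, j, s)
  let blk : ℕ → List ((ℕ × ℕ) ⊕ (ℕ × ℕ × Bool)) := fun b =>
    tl false b ++ wl b ++ (tl true b).reverse
  let idx : (ℕ × ℕ) ⊕ (ℕ × ℕ × Bool) → ℕ := Sum.elim Prod.fst Prod.fst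
  have hL : 0 < L := Nat.pos_of_ne_zero (NeZero.ne L)
  have hwl : ∀ b, wl b ≠ [] := fun b => by simp [wl, hL.ne']
  have hinv : ∀ b, IsInverseList c v (tl false b) (tl true b).reverse := by
    intro b
    simp only [IsInverseList, List.reverse_reverse, tl]
    rw [List.forall₂_map_left_iff, List.forall₂_map_right_iff, List.forall₂_same]
    intro j _
    refine ⟨rfl, ?_⟩
    simp only [v, a]
    rw [← map_mul, mul_inv_cancel, map_one]
  have hwlv : ∀ b, ((wl b).map v).prod = W := by
    intro b
    rw [← hW, List.map_map]
    rfl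
  have htlv : ∀ b, ((tl false b).map v).prod = u b := by
    intro b
    rw [← hU b]
    conv_rhs => rw [← map_range_getD (U b) (x 0)]
    simp only [tl, List.map_map]
    rfl
  have hblkv : ∀ b, ((blk b).map v).prod = u b * W * (u b)⁻¹ := by
    intro b
    simp only [blk, List.map_append, List.prod_append]
    rw [(hinv b).prod_eq_inv, htlv, hwlv]
  have hwlidx : ∀ b, ∀ z ∈ wl b, idx z = b := by
    intro b z hz
    obtain ⟨j, _, rfl⟩ := List.mem_map.1 hz
    rfl
  have htlidx : ∀ s b, ∀ z ∈ tl s b, idx z = b := by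
    intro s b z hz
    obtain ⟨j, _, rfl⟩ := List.mem_map.1 hz
    rfl
  have hblkidx : ∀ b, ∀ z ∈ blk b, idx z = b := by
    intro b z hz
    simp only [blk, List.mem_append, List.mem_reverse] at hz
    rcases hz with (hz | hz) | hz
    · exact htlidx _ _ _ hz
    · exact hwlidx _ _ hz
    · exact htlidx _ _ _ hz
  have hwln : ∀ b, (wl b).Nodup := fun b =>
    List.nodup_range.map fun i j hij => by simpa using hij
  have htln : ∀ s b, (tl s b).Nodup := fun s b =>
    List.nodup_range.map fun i j hij => by simpa using hij
  have hblkn : ∀ b, (blk b).Nodup := by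
    intro b
    simp only [blk]
    rw [List.nodup_append', List.nodup_append', List.nodup_reverse]
    refine ⟨⟨htln _ _, hwln _, ?_⟩, htln _ _, ?_⟩
    · intro z h1 h2
      simp only [tl, wl, List.mem_map] at h1 h2
      obtain ⟨j, _, rfl⟩ := h1
      obtain ⟨j', _, h'⟩ := h2
      simp at h'
    · intro z h1 h2
      simp only [tl, wl, List.mem_map, List.mem_append, List.mem_reverse] at h1 h2
      obtain ⟨j, _, rfl⟩ := h2
      rcases h1 with ⟨j', _, h'⟩ | ⟨j', _, h'⟩ <;> simp at h'
  have hbig : ((List.range n).flatMap blk ++ wl n).Nodup := by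
    rw [List.nodup_append', List.nodup_flatMap]
    refine ⟨⟨fun b _ => hblkn b, ?_⟩, hwln n, ?_⟩
    · refine List.nodup_range.pairwise_of_forall_ne fun b _ b' _ hbb z h1 h2 => ?_
      exact hbb ((hblkidx b z h1).symm.trans (hblkidx b' z h2))
    · intro z h1 h2
      obtain ⟨b, hb, hz⟩ := List.mem_flatMap.1 h1
      have h3 := hblkidx b z hz
      have h4 := hwlidx n z h2
      simp at hb
      omega
  have hdisc : CircleFilling c v [(List.range n).flatMap blk ++ wl n] := by
    refine circleFilling_of_prod_eq_one (((List.range n).flatMap blk ++ wl n).length - 1)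
      (fun z => ⟨(a z).2, rfl⟩) ?_ hbig ?_
    · have : (wl n).length = L := by simp [wl]
      rw [List.length_append, this]; omega
    · rw [List.map_append, List.prod_append, hwlv, List.map_flatMap, List.flatMap_def,
        List.prod_flatten, List.map_map]
      rw [show List.prod ∘ (fun b => (blk b).map v) = fun b => u b * W * (u b)⁻¹ from
        funext hblkv]
      exact h
  have hcut : ∀ (bs : List ℕ) (D : List (List ((ℕ × ℕ) ⊕ (ℕ × ℕ × Bool)))),
      CircleFilling c v ((bs.flatMap blk ++ wl n) :: D) →
      CircleFilling c v (bs.map wl ++ wl n :: D) := by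
    intro bs
    induction bs with
    | nil => intro D h; simpa using h
    | cons b bs ih =>
      intro D h
      have h1 := CircleFilling.cut_conj (hwl b) _ _ (hinv b) (r := bs.flatMap blk ++ wl n)
        (by simp [hwl]) (C := D) (by simpa [blk] using h)
      refine (ih _ (h1.perm (List.Perm.swap ..))).perm ?_
      have := List.perm_middle (a := wl b) (l₁ := bs.map wl ++ [wl n]) (l₂ := D)
      simpa using this
  have hfin : CircleFilling c v ((List.range (n + 1)).map wl) := by
    rw [List.range_succ, List.map_append]
    exact hcut _ _ hdisc
  have hmem : ∀ z ∈ ((List.range (n + 1)).map wl).flatten, ∃ b < n + 1, ∃ j < L,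
      z = .inl (b, j) := by
    intro z hz
    simp only [List.mem_flatten, List.mem_map, List.mem_range] at hz
    obtain ⟨_, ⟨b, hb, rfl⟩, hz⟩ := hz
    simp only [wl, List.mem_map, List.mem_range] at hz
    obtain ⟨j, hj, rfl⟩ := hz
    exact ⟨b, hb, j, hj, rfl⟩
  refine hfin.2.false_of_card_eq ?_ (Sum.elim (fun z => (z.2 : ZMod L)) fun _ => 0)
    (fun j => (x j).1) (fun j => CoprodI.of (x j).2) ?_ ?_ ?_ hxc ?_ ?_
  · rw [List.toFinset_card_of_nodup hfin.1]
    simp [wl, List.length_flatten, Function.comp_def]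
  · intro z hz
    obtain ⟨b, hb, j, hj, rfl⟩ := hmem z (by simpa using hz)
    have hj' : j < (wl b).length := by simpa [wl] using hj
    have e : Sum.inl (b, j) = (wl b)[j] := by simp [wl]
    rw [prod_map_formPerm_apply_of_mem hfin.1 (l := wl b)
      (List.mem_map_of_mem (by simpa using hb)) (by simp [wl, hj]), e,
      List.formPerm_apply_getElem _ (hwln b)]
    simp [wl]
  · intro z hz
    exact prod_map_formPerm_apply_of_notMem (by simpa using hz)
  · intro z hz
    obtain ⟨b, hb, j, hj, rfl⟩ := hmem z (by simpa using hz)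
    rfl
  · intro z hz
    obtain ⟨b, hb, j, hj, rfl⟩ := hmem z (by simpa using hz)
    rfl
  · intro j
    rw [injective_pow_iff_not_isOfFinOrder]
    intro hfo
    exact hx1 j (hK _ _ ((CoprodI.of_injective _).isOfFinOrder_iff.1 hfo))

/-- An element of a free product has a conjugate in a factor or a conjugate spelled by a
cyclically reduced word of length at least two. -/
theorem exists_cyclically_reduced (g : CoprodI K) :
    g = 1 ∨ (∃ (i : I) (a : K i) (y : CoprodI K), g = y * CoprodI.of a * y⁻¹) ∨
      ∃ (L : ℕ) (_ : NeZero L) (x : ZMod L → Σ i, K i) (y : CoprodI K),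
        (∀ j, (x j).2 ≠ 1) ∧ (∀ j, (x j).1 ≠ (x (j + 1)).1) ∧
        g = y * ((List.range L).map fun j : ℕ => (CoprodI.of (x j).2 : CoprodI K)).prod * y⁻¹ := by
  classical
  let pr : List (Σ i, K i) → CoprodI K := fun l => (l.map fun a => CoprodI.of a.2).prod
  have hpr : ∀ l l', pr (l ++ l') = pr l * pr l' := fun l l' => by simp [pr]
  -- A shortest word among those spelling conjugates of `g` is cyclically reduced.
  have hex : ∃ n, ∃ (l : List (Σ i, K i)) (y : CoprodI K), l.length = n ∧ g = y * pr l * y⁻¹ := by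
    obtain ⟨l, hl⟩ := exists_letters g
    exact ⟨_, l, 1, rfl, by simp [pr, hl]⟩
  obtain ⟨l, y, hl, hg⟩ := Nat.find_spec hex
  have hmin : ∀ (l' : List (Σ i, K i)) (y' : CoprodI K), g = y' * pr l' * y'⁻¹ →
      l.length ≤ l'.length := fun l' y' h => by
    rw [hl]; exact Nat.find_min' hex ⟨l', y', rfl, h⟩
  rcases Nat.eq_zero_or_pos l.length with h0 | h0
  · left
    rw [List.length_eq_zero_iff] at h0
    simpa [h0, pr] using hg
  rcases Nat.eq_or_lt_of_le (Nat.succ_le_of_lt h0) with h1 | h1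
  · right; left
    obtain ⟨a, rfl⟩ := List.length_eq_one_iff.1 h1.symm
    exact ⟨a.1, a.2, y, by simpa [pr] using hg⟩
  right; right
  have : NeZero l.length := ⟨h0.ne'⟩
  refine ⟨l.length, this, fun j => l[j.val]'j.val_lt, y, fun j hj => ?_, fun j hj => ?_, ?_⟩
  · have e : l = l.take j.val ++ l[j.val]'j.val_lt :: l.drop (j.val + 1) := by
      simp
    have e2 : pr l = pr (l.take j.val ++ l.drop (j.val + 1)) := by
      conv_lhs => rw [e]
      rw [hpr, hpr]
      simp only [pr, List.map_cons, List.prod_cons, hj, map_one, one_mul]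
    have := hmin _ y (by rw [← e2]; exact hg)
    have := j.val_lt
    simp at *
    omega
  · have hval : (j + 1).val = (1 + j.val) % l.length := by
      rw [ZMod.val_add, ZMod.val_one_eq_one_mod]
      simp [add_comm]
    -- Rotation is conjugation, so cyclic neighbours from one factor can be brought to the front and
    -- multiplied, giving a shorter word.
    have hr : pr l = pr (l.take j.val) * pr (l.rotate j.val) * (pr (l.take j.val))⁻¹ := by
      have e : pr l = pr (l.take j.val) * pr (l.drop j.val) := by
        rw [← hpr, List.take_append_drop]
      rw [List.rotate_eq_drop_append_take j.val_lt.le, hpr, e]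
      group
    have hlen : (l.rotate j.val).length = l.length := l.length_rotate j.val
    obtain ⟨p, q, t, hm⟩ : ∃ p q t, l.rotate j.val = p :: q :: t := by
      match hm : l.rotate j.val with
      | [] => simp [hm] at hlen; omega
      | [_] => simp [hm] at hlen; omega
      | p :: q :: t => exact ⟨p, q, t, rfl⟩
    have hp : p = l[j.val]'j.val_lt := by
      have : (l.rotate j.val)[0]'(by omega) = p := by simp [hm]
      rw [← this, List.getElem_rotate]
      simp [Nat.mod_eq_of_lt j.val_lt]
    have hq : q = l[(j + 1).val]'(j + 1).val_lt := by
      have : (l.rotate j.val)[1]'(by omega) = q := by simp [hm]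
      rw [← this, List.getElem_rotate]
      simp [hval]
    simp only [← hp, ← hq] at hj
    obtain ⟨i, a⟩ := p
    obtain ⟨i', b⟩ := q
    obtain rfl : i = i' := hj
    have e2 : pr (l.rotate j.val) = pr (⟨i, a * b⟩ :: t) := by
      rw [hm]; simp [pr, mul_assoc]
    have := hmin (⟨i, a * b⟩ :: t) (y * pr (l.take j.val)) (by
      rw [hg, hr, e2]; group)
    rw [hm] at hlen
    simp at this hlen
    omega
  · rw [hg]
    congr 2
    simp only [pr]
    congr 1
    refine List.ext_getElem (by simp) fun i h1 h2 => ?_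
    have hi : i < l.length := by simpa using h1
    have key : ∀ (m : ℕ) (hm : m < l.length), m = i →
        (CoprodI.of l[i].2 : CoprodI K) = CoprodI.of l[m].2 := by
      rintro _ _ rfl; rfl
    simp only [List.getElem_map]
    refine key _ _ ?_
    rw [List.getElem_range, ZMod.val_cast_of_lt hi]

end

/-! ### Spectra under homomorphisms and free products -/

namespace GenTorsion

section

variable {G H : Type*} [Group G] [Group H]

theorem eqnSpectrum_subset_map (f : G →* H) (g : G) : eqnSpectrum g ⊆ eqnSpectrum (f g) := by
  rintro n ⟨hn, x, hx⟩
  refine ⟨hn, fun i => f (x i), ?_⟩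
  have := congrArg f hx
  rw [map_one, map_list_prod, List.map_ofFn] at this
  simpa [Function.comp_def] using this

theorem eqnSpectrum_conj_subset (y g : G) : eqnSpectrum (y * g * y⁻¹) ⊆ eqnSpectrum g := by
  rintro n ⟨hn, x, hx⟩
  refine ⟨hn, fun i => x i * y, ?_⟩
  simpa [mul_assoc] using hx

theorem eqnSpectrum_conj (y g : G) : eqnSpectrum (y * g * y⁻¹) = eqnSpectrum g := by
  refine (eqnSpectrum_conj_subset y g).antisymm ?_
  have := eqnSpectrum_conj_subset y⁻¹ (y * g * y⁻¹)
  rwa [show y⁻¹ * (y * g * y⁻¹) * y⁻¹⁻¹ = g by group] at this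

theorem nonempty_eqnSpectrum_of_isOfFinOrder {g : G} (hg : IsOfFinOrder g) :
    (eqnSpectrum g).Nonempty :=
  ⟨orderOf g, hg.orderOf_pos, fun _ => 1, by simp [pow_orderOf_eq_one]⟩

theorem strictGordSpectrum_eq (hG : TorsionFree G) :
    strictGordSpectrum G = gordSpectrum G := by
  ext n
  exact ⟨fun ⟨g, h, _, h'⟩ => ⟨g, h, h'⟩, fun ⟨g, h, h'⟩ => ⟨g, h, fun hf => h.1 (hG g hf), h'⟩⟩

theorem gord_eq_of_isLeast {g : G} {n : ℕ} (h : IsLeast (eqnSpectrum g) n) : gord g = n :=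
  IsLeast.csInf_eq ⟨⟨n, h.1, rfl⟩, by
    rintro _ ⟨m, hm, rfl⟩
    exact Nat.cast_le.2 (h.2 hm)⟩

end

section FreeProducts

variable {I : Type*} {K : I → Type*} [∀ i, Group (K i)]

/-- The factor is a retract of the free product, and homomorphisms only enlarge the spectrum. -/
theorem eqnSpectrum_of (i : I) (a : K i) :
    eqnSpectrum (CoprodI.of a : CoprodI K) = eqnSpectrum a := by
  classical
  refine subset_antisymm ?_ (eqnSpectrum_subset_map CoprodI.of a)
  have h := eqnSpectrum_subset_map
    (CoprodI.lift (Pi.mulSingle i (MonoidHom.id (K i)))) (CoprodI.of a : CoprodI K)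
  rwa [CoprodI.of_leftInverse i a] at h

/-- In a free product of torsion-free groups every generalized torsion element has a conjugate in
a factor. -/
theorem exists_conj_of_nonempty_eqnSpectrum (hK : ∀ i, TorsionFree (K i)) {g : CoprodI K}
    (hg : g ≠ 1) (h : (eqnSpectrum g).Nonempty) :
    ∃ (i : I) (a : K i) (y : CoprodI K), g = y * CoprodI.of a * y⁻¹ := by
  rcases exists_cyclically_reduced g with h1 | h1 | ⟨L, _, x, y, hx1, hxc, rfl⟩
  · exact absurd h1 hg
  · exact h1
  exfalso
  rw [eqnSpectrum_conj] at h
  obtain ⟨n, hn, u, hu⟩ := h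
  obtain ⟨n, rfl⟩ := Nat.exists_eq_succ_of_ne_zero hn.ne'
  set W := ((List.range L).map fun j : ℕ => (CoprodI.of (x j).2 : CoprodI K)).prod with hW
  set t := u (Fin.last n) with ht
  -- Conjugating the whole relation by `t⁻¹` strips the last factor of its conjugator.
  refine false_of_prod_conj_mul_eq_one hK x hx1 hxc n
    (fun b => if hb : b < n then t⁻¹ * u (Fin.castSucc ⟨b, hb⟩) else 1) W rfl ?_
  have e : (List.range n).map (fun b => (if hb : b < n then t⁻¹ * u (Fin.castSucc ⟨b, hb⟩) else 1) *
      W * (if hb : b < n then t⁻¹ * u (Fin.castSucc ⟨b, hb⟩) else 1)⁻¹) =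
      (List.ofFn fun i : Fin n => u i.castSucc * W * (u i.castSucc)⁻¹).map
        (MulAut.conj t⁻¹).toMonoidHom := by
    refine List.ext_getElem (by simp) fun b h1 h2 => ?_
    have hb : b < n := by simpa using h1
    simp [hb, mul_assoc]
  rw [e, ← map_list_prod]
  rw [List.ofFn_succ', List.concat_eq_append, List.prod_append, List.prod_singleton] at hu
  have hu' := eq_inv_of_mul_eq_one_left hu
  rw [hu', ← ht]
  simp [mul_assoc]

/-- Torsion is a special case of generalized torsion, so it too is conjugate into a factor. -/
theorem torsionFree_coprodI (hK : ∀ i, TorsionFree (K i)) : TorsionFree (CoprodI K) := by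
  intro g hg
  by_contra hg1
  obtain ⟨i, a, y, rfl⟩ := exists_conj_of_nonempty_eqnSpectrum hK hg1
    (nonempty_eqnSpectrum_of_isOfFinOrder hg)
  have h : IsOfFinOrder (CoprodI.of a : CoprodI K) := (Function.Injective.isOfFinOrder_iff
    (f := (MulAut.conj y).toMonoidHom) (MulAut.conj y).injective).1 hg
  rw [(CoprodI.of_injective i).isOfFinOrder_iff] at h
  exact hg1 (by simp [hK i a h])

theorem gordSpectrum_coprodI (hK : ∀ i, TorsionFree (K i)) :
    gordSpectrum (CoprodI K) = ⋃ i, gordSpectrum (K i) := by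
  ext n
  rw [Set.mem_iUnion]
  constructor
  · rintro ⟨g, ⟨h1, h2⟩, h3⟩
    obtain ⟨i, a, y, rfl⟩ := exists_conj_of_nonempty_eqnSpectrum hK h1 h2
    rw [gord, eqnSpectrum_conj, eqnSpectrum_of] at h3
    rw [eqnSpectrum_conj, eqnSpectrum_of] at h2
    exact ⟨i, a, ⟨by rintro rfl; simp at h1, h2⟩, h3⟩
  · rintro ⟨i, a, ⟨h1, h2⟩, h3⟩
    refine ⟨CoprodI.of a, ⟨?_, by rwa [eqnSpectrum_of]⟩, by rw [gord, eqnSpectrum_of]; exact h3⟩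
    rwa [Ne, ← map_one CoprodI.of, (CoprodI.of_injective i).eq_iff]

theorem countable_coprodI [Countable I] [∀ i, Countable (K i)] : Countable (CoprodI K) :=
  have h : Function.Surjective fun l : List (Σ i, K i) =>
      (l.map fun a : Σ i, K i => (CoprodI.of a.2 : CoprodI K)).prod := exists_letters
  h.countable

end FreeProducts

/-! ### Affine groups with a single generalized torsion order -/

section Affine

/-- The group of affine maps `a ↦ r ^ k * a + b` of `ℚ`, for `k` an integer and `b` rational, as
a semidirect product. -/
abbrev powAffine (r : ℚˣ) : Type :=
  Multiplicative ℚ ⋊[((MulAutMultiplicative ℚ).symm.toMonoidHom.comp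
    (DistribMulAction.toAddAut ℚˣ ℚ)).comp (zpowersHom ℚˣ r)] Multiplicative ℤ

variable {r : ℚˣ}

theorem powAffine.conj_inl (x : powAffine r) (a : ℚ) :
    x * SemidirectProduct.inl (Multiplicative.ofAdd a) * x⁻¹ =
      SemidirectProduct.inl
        (Multiplicative.ofAdd (((r ^ x.right.toAdd : ℚˣ) : ℚ) * a)) := by
  ext
  · simp only [SemidirectProduct.mul_left, SemidirectProduct.mul_right,
      SemidirectProduct.inv_left, SemidirectProduct.left_inl, SemidirectProduct.right_inl, mul_one,
      ← MulAut.mul_apply, ← map_mul, mul_inv_cancel, map_one, MulAut.one_apply]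
    rw [mul_right_comm, mul_inv_cancel, one_mul]
    rfl
  · rw [SemidirectProduct.mul_right, SemidirectProduct.mul_right, SemidirectProduct.inv_right,
      SemidirectProduct.right_inl, SemidirectProduct.right_inl, mul_one, mul_inv_cancel]

theorem powAffine.mem_eqnSpectrum_inl {a : ℚ} {k : ℕ} :
    k ∈ eqnSpectrum (SemidirectProduct.inl (Multiplicative.ofAdd a) : powAffine r) ↔
      0 < k ∧ ∃ e : Fin k → ℤ, ∑ i, ((r ^ e i : ℚˣ) : ℚ) * a = 0 := by
  have key : ∀ b : Fin k → ℚ, (List.ofFn fun i => (SemidirectProduct.inl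
      (Multiplicative.ofAdd (b i)) : powAffine r)).prod = 1 ↔ ∑ i, b i = 0 := by
    intro b
    rw [show (List.ofFn fun i => (SemidirectProduct.inl (Multiplicative.ofAdd (b i)) :
        powAffine r)) = (List.ofFn fun i => Multiplicative.ofAdd (b i)).map SemidirectProduct.inl by
        rw [List.map_ofFn]; rfl, ← map_list_prod,
      List.prod_ofFn, ← ofAdd_sum, map_eq_one_iff _ SemidirectProduct.inl_injective,
      ofAdd_eq_one]
  refine and_congr_right fun _ => ⟨fun ⟨x, hx⟩ => ?_, fun ⟨e, he⟩ => ?_⟩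
  · simp only [powAffine.conj_inl] at hx
    exact ⟨fun i => (x i).right.toAdd, (key _).1 hx⟩
  · refine ⟨fun i => SemidirectProduct.inr (Multiplicative.ofAdd (e i)), ?_⟩
    simp only [powAffine.conj_inl]
    exact (key _).2 he

/-- In the abelian quotient ℤ a product of `k` conjugates is a `k`-th power, and ℤ is torsion-free.
-/
theorem powAffine.eq_inl_of_nonempty {g : powAffine r} (h : (eqnSpectrum g).Nonempty) :
    g = SemidirectProduct.inl g.left := by
  obtain ⟨k, h⟩ := h
  obtain ⟨hk, x, hx⟩ := eqnSpectrum_subset_map SemidirectProduct.rightHom g h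
  have : (SemidirectProduct.rightHom g) ^ k = 1 := by
    simpa [mul_comm, mul_assoc] using hx
  have h1 : SemidirectProduct.rightHom g = 1 := (pow_eq_one_iff.1 this).resolve_right hk.ne'
  exact SemidirectProduct.ext rfl h1

/-- Multiplying by `r ^ M` makes all exponents nonnegative; modulo `n` each of the `k` integer terms
is then 1. -/
theorem dvd_of_sum_zpow_eq_zero {n k : ℕ} {r : ℚˣ} (hr : (r : ℚ) = 1 - n) (e : Fin k → ℤ)
    (h : ∑ i, ((r ^ e i : ℚˣ) : ℚ) = 0) : n ∣ k := by
  let M : ℕ := ∑ i, (e i).natAbs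
  have hM : ∀ i, (((e i + M).toNat : ℕ) : ℤ) = e i + M := by
    intro i
    have : (e i).natAbs ≤ M :=
      Finset.single_le_sum (f := fun i => (e i).natAbs) (fun _ _ => Nat.zero_le _)
        (Finset.mem_univ i)
    omega
  have h1 : ∑ i, (1 - (n : ℤ)) ^ (e i + M).toNat = 0 := by
    have h2 : ((∑ i, (1 - (n : ℤ)) ^ (e i + M).toNat : ℤ) : ℚ) =
        (∑ i, ((r ^ e i : ℚˣ) : ℚ)) * (r : ℚ) ^ M := by
      rw [Finset.sum_mul]
      push_cast
      refine Finset.sum_congr rfl fun i _ => ?_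
      rw [← hr, ← zpow_natCast, hM, zpow_add₀ r.ne_zero, zpow_natCast]
    rw [h, zero_mul] at h2
    exact_mod_cast h2
  have h3 := congrArg (Int.cast : ℤ → ZMod n) h1
  push_cast at h3
  simpa [ZMod.natCast_eq_zero_iff] using h3

theorem powAffine.torsionFree (r : ℚˣ) : TorsionFree (powAffine r) := by
  intro g hg
  have e := powAffine.eq_inl_of_nonempty (nonempty_eqnSpectrum_of_isOfFinOrder hg)
  rw [e] at hg
  rw [SemidirectProduct.inl_injective.isOfFinOrder_iff] at hg
  have : g.left = 1 := by
    by_contra h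
    exact not_isOfFinOrder_of_isMulTorsionFree h hg
  rw [e, this, map_one]

theorem powAffine.isLeast_eqnSpectrum {n : ℕ} (hn : 2 ≤ n) (hr : (r : ℚ) = 1 - n) {a : ℚ}
    (ha : a ≠ 0) : IsLeast (eqnSpectrum
      (SemidirectProduct.inl (Multiplicative.ofAdd a) : powAffine r)) n := by
  constructor
  · rw [powAffine.mem_eqnSpectrum_inl]
    obtain ⟨m, rfl⟩ : ∃ m, n = m + 1 := ⟨n - 1, by omega⟩
    -- One exponent 1 and `n - 1` exponents 0: `(1 - n) + (n - 1) = 0`.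
    refine ⟨by omega, Fin.cons 1 fun _ => 0, ?_⟩
    rw [Fin.sum_univ_succ]
    simp [hr]
  · intro k hk
    rw [powAffine.mem_eqnSpectrum_inl] at hk
    obtain ⟨hk, e, he⟩ := hk
    rw [← Finset.sum_mul, mul_eq_zero, or_iff_left ha] at he
    exact Nat.le_of_dvd hk (dvd_of_sum_zpow_eq_zero hr e he)

theorem powAffine.gordSpectrum_eq {n : ℕ} (hn : 2 ≤ n) (hr : (r : ℚ) = 1 - n) :
    gordSpectrum (powAffine r) = {n} := by
  ext k
  rw [Set.mem_singleton_iff]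
  constructor
  · rintro ⟨g, ⟨h1, h2⟩, h3⟩
    have hg := powAffine.eq_inl_of_nonempty h2
    have ha : g.left.toAdd ≠ 0 := by
      intro h
      apply h1
      rw [hg, toAdd_eq_zero.1 h, map_one]
    have := gord_eq_of_isLeast (powAffine.isLeast_eqnSpectrum hn hr ha)
    rw [ofAdd_toAdd, ← hg, h3] at this
    exact_mod_cast this
  · rintro rfl
    have h := powAffine.isLeast_eqnSpectrum hn hr one_ne_zero
    refine ⟨_, ⟨?_, _, h.1⟩, gord_eq_of_isLeast h⟩
    rw [Ne, map_eq_one_iff _ SemidirectProduct.inl_injective, ofAdd_eq_one]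
    exact one_ne_zero

theorem powAffine.countable (r : ℚˣ) : Countable (powAffine r) :=
  Function.Injective.countable (f := fun g : powAffine r => (g.left.toAdd, g.right.toAdd))
    fun g h e => by
      rw [Prod.mk.injEq] at e
      exact SemidirectProduct.ext e.1 e.2

end Affine

end GenTorsion

/-! ### Realizing a prescribed spectrum -/

theorem mainTheorem7 (A : Set ℕ) (hA : ∀ n ∈ A, 2 ≤ n) :
    ∃ (G : Type) (_ : Group G) (K : A → Type) (_ : ∀ n : A, Group (K n)),
      Countable G ∧ GenTorsion.TorsionFree G ∧
      GenTorsion.strictGordSpectrum G = A ∧ GenTorsion.gordSpectrum G = A ∧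
      Nonempty (G ≃* Monoid.CoprodI K) ∧
      ∀ n : A, Countable (K n) ∧ GenTorsion.TorsionFree (K n) ∧
        GenTorsion.strictGordSpectrum (K n) = {(n : ℕ)} ∧
        GenTorsion.gordSpectrum (K n) = {(n : ℕ)} := by
  have hr : ∀ n : A, (1 - ((n : ℕ) : ℚ)) ≠ 0 := fun n => by
    have : (2 : ℚ) ≤ (n : ℕ) := by exact_mod_cast hA n n.2
    linarith
  let K : A → Type := fun n => GenTorsion.powAffine (Units.mk0 _ (hr n))
  have hK : ∀ n, GenTorsion.TorsionFree (K n) := fun n => GenTorsion.powAffine.torsionFree _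
  have hspec : ∀ n : A, GenTorsion.gordSpectrum (K n) = {(n : ℕ)} := fun n =>
    GenTorsion.powAffine.gordSpectrum_eq (hA n n.2) rfl
  have hcount : ∀ n, Countable (K n) := fun n => GenTorsion.powAffine.countable _
  have htf := GenTorsion.torsionFree_coprodI hK
  have hG : GenTorsion.gordSpectrum (Monoid.CoprodI K) = A := by
    rw [GenTorsion.gordSpectrum_coprodI hK]
    ext m
    simp [hspec]
  exact ⟨Monoid.CoprodI K, inferInstance, K, inferInstance, GenTorsion.countable_coprodI, htf,
    (GenTorsion.strictGordSpectrum_eq htf).trans hG, hG, ⟨MulEquiv.refl _⟩, fun n =>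
    ⟨hcount n, hK n, (GenTorsion.strictGordSpectrum_eq (hK n)).trans (hspec n), hspec n⟩⟩
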